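/- \textbf{Setting.} A finite episodic MDP $\mathcal M=(\mathcal X,\mathcal A,H,P,r)$ with initial distribution $\xi_0$ has finite state space $\mathcal X$ and action space $\mathcal A$, episode length $H$, a time-homogeneous transition kernel $P(\cdot\mid x,a)$ and a deterministic reward $r:\mathcal X\times\mathcal A\to[0,1]$. Given a feature map $\phi:\mathcal X\times\mathcal A\to\mathbb R^d$, the MDP is \emph{linear} if the space of functions $(x,a)\mapsto\phi(x,a)^\top w$, $w\in\mathbb R^d$, is closed under $f\mapsto r(x,a)+\mathbb E_{x'\sim P(\cdot|x,a),\,a'\sim\pi(\cdot|x')}[f(x',a')]$ for every stationary policy $\pi$; it is \emph{$(s,\phi)$-sparse} if moreover there are $\mathcal K\subseteq\{1,\dots,d\}$ with $|\mathcal K|\le s$ and functions $\psi_k:\mathcal X\to\mathbb R$ with $P(x'\mid x,a)=\sum_{k\in\mathcal K}\phi_k(x,a)\psi_k(x')$ for all $x,a,x'$. For a stationary policy $\pi$ let $$\Sigma^\pi=\mathbb E^\pi\Big[\frac1H\sum_{h=1}^H\phi(x_h,a_h)\phi(x_h,a_h)^\top\Big],$$ where $x_1\sim\xi_0$, $a_h\sim\pi(\cdot\mid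 x_h)$, $x_{h+1}\sim P(\cdot\mid x_h,a_h)$; $\pi$ is \emph{exploratory} if the smallest singular value $\sigma_{\min}(\Sigma^\pi)$ is positive. A learning algorithm chooses, before each episode $n$ and from the data of the previous episodes, a (randomised, history-dependent) policy $\pi_n$ to be executed in episode $n$; its expected regret over $N$ episodes is $$R_N=\mathbb E\Big[\sum_{n=1}^N\big(V_1^*(x_1^n)-V_1^{\pi_n}(x_1^n)\big)\Big],$$ where $V_1^\pi(x)$ is the expected total reward of an episode started at $x$ under $\pi$, and $V_1^*=\sup_\pi V_1^\pi$. \textbf{Theorem.} There are universal constants $S,s\in\mathbb N$ and $c>0$ and numbers $A_d\ge d$ ($d\in\mathbb N$) such that the following holds for all $d\ge5$ and $H\ge2$. There are an initial distribution $\xi_0$, a reward function $r$ and a feature map $\phi$ with values in $\mathbb R^d$ and $\|\phi(x,a)\|_\infty\le1$, on $S$ states and $A_d$ actions, such that for every learning algorithm (which may depend on $H,\xi_0,r,\phi$) there is an $(s,\phi)$-sparse linear MDP with these $H,\xi_0,r$ which has an exploratory policy $\pi_e$ with $\sigma_{\min}(\Sigma^{\pi_e})\ge c$, and on which $$R_N\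 \ge\ \frac{1}{128}HN\quad\text{for all }N\le d,\qquad\text{and}\qquad R_N\ \ge\ \frac1{128}Hd\quad\text{for all }N\ge d .$$ In particular $R_d\ge Hd/128$: regret linear in the number of episodes cannot be avoided in the high-dimensional regime $N\le d$, even though an exploratory policy exists. -/

import Mathlib

open scoped BigOperators

noncomputable section

/-- A finite episodic Markov decision process with state space `X` and action space `A`:
horizon (episode length) `H`, initial distribution `ξ₀`, time-homogeneous transition kernel `P`
and deterministic reward function with values in `[0, 1]`. -/
structure EpisodicMDP (X A : Type*) [Fintype X] where
  horizon : ℕ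
  init : stdSimplex ℝ X
  trans : X → A → stdSimplex ℝ X
  reward : X → A → Set.Icc (0 : ℝ) 1

/-- A stationary (randomised) policy. -/
abbrev StationaryPolicy (X A : Type*) [Fintype A] := X → stdSimplex ℝ A

/-- A nonstationary (randomised) policy for one episode: the distribution of the next action may
depend on all the state-action pairs of the current episode so far (in chronological order) and on
the current state. -/
abbrev HistoryPolicy (X A : Type*) [Fintype A] := List (X × A) → X → stdSimplex ℝ A

/-- The record of one episode: the list `(x₁, a₁), …, (x_H, a_H)` and the final state
`x_{H+1}`. -/
abbrev Episode (X A : Type*) := List (X × A) × X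

/-- A learning algorithm: from the records of all past episodes (in chronological order) it
chooses the (history-dependent, randomised) policy executed in the next episode. -/
abbrev Algorithm (X A : Type*) [Fintype A] := List (Episode X A) → HistoryPolicy X A

namespace EpisodicMDP

variable {X A : Type*} [Fintype X] [Fintype A] (M : EpisodicMDP X A)

/-- `M.episodeExpect π f m hist x` is the expectation of `f` (a function of the record of the
episode) when `m` steps remain to be played, `hist` is the history of the current episode, `x` is
the current state, actions are drawn from `π` and next states from the transition kernel. -/
def episodeExpect (π : HistoryPolicy X A) (f : Episode X A → ℝ) : ℕ → List (X × A) → X → ℝ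
  | 0, hist, x => f (hist, x)
  | m + 1, hist, x =>
      ∑ a, π hist x a * ∑ x', M.trans x a x' * episodeExpect π f m (hist ++ [(x, a)]) x'

/-- The total reward collected in an episode. -/
def totalReward (e : Episode X A) : ℝ :=
  (e.1.map fun p => (M.reward p.1 p.2 : ℝ)).sum

/-- The value `V₁^π(x)`: the expected total reward of an episode started at `x` and played with
the policy `π`. -/
def value (π : HistoryPolicy X A) (x : X) : ℝ :=
  M.episodeExpect π M.totalReward M.horizon [] x

/-- The optimal value `V₁^*(x) = sup_π V₁^π(x)`. -/
def optValue (x : X) : ℝ := ⨆ π : HistoryPolicy X A, M.value π x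

/-- Expected cumulative regret of the next `N` episodes, given the records `past` of the past
episodes. -/
def regretFrom (alg : Algorithm X A) : ℕ → List (Episode X A) → ℝ
  | 0, _ => 0
  | N + 1, past =>
      ∑ x, M.init x *
        (M.optValue x - M.value (alg past) x +
          M.episodeExpect (alg past) (fun e => regretFrom alg N (past ++ [e])) M.horizon [] x)

/-- The expected cumulative regret
`R_N = 𝔼 [∑_{n ≤ N} (V₁^*(x₁ⁿ) - V₁^{πₙ}(x₁ⁿ))]` of the algorithm over `N` episodes. -/
def regret (alg : Algorithm X A) (N : ℕ) : ℝ := M.regretFrom alg N []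

/-- The distribution of the state `x_{h+1}` (so `h = 0` is the first step of the episode) under a
stationary policy. -/
def stateLaw (π : StationaryPolicy X A) : ℕ → X → ℝ
  | 0, x => M.init x
  | h + 1, x' => ∑ x, ∑ a, stateLaw π h x * π x a * M.trans x a x'

/-- The expected uncentered covariance matrix
`Σ^π = 𝔼^π [(1/H) ∑_{h=1}^{H} φ(x_h, a_h) φ(x_h, a_h)ᵀ]`. -/
def covariance {d : ℕ} (φ : X → A → Fin d → ℝ) (π : StationaryPolicy X A) :
    Matrix (Fin d) (Fin d) ℝ :=
  (1 / (M.horizon : ℝ)) • ∑ h ∈ Finset.range M.horizon, ∑ x, ∑ a,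
    (M.stateLaw π h x * π x a) • Matrix.vecMulVec (φ x a) (φ x a)

/-- The operator `[T_π f](x, a) = r(x, a) + 𝔼_{x' ∼ P(· | x, a), a' ∼ π(· | x')} [f(x', a')]`. -/
def bellmanOp (π : StationaryPolicy X A) (f : X → A → ℝ) : X → A → ℝ := fun x a =>
  (M.reward x a : ℝ) + ∑ x', M.trans x a x' * ∑ a', π x' a' * f x' a'

end EpisodicMDP

/-- The space of functions that are linear in the feature map `φ`. -/
def linearFunctions {X A : Type*} {d : ℕ} (φ : X → A → Fin d → ℝ) : Set (X → A → ℝ) :=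
  {g | ∃ w : Fin d → ℝ, ∀ x a, g x a = φ x a ⬝ᵥ w}

namespace EpisodicMDP

variable {X A : Type*} [Fintype X] [Fintype A] (M : EpisodicMDP X A)

/-- The MDP is linear in `φ`: the functions linear in `φ` are closed under the Bellman operators of
all policies. -/
def IsLinear {d : ℕ} (φ : X → A → Fin d → ℝ) : Prop :=
  ∀ π : StationaryPolicy X A, ∀ f ∈ linearFunctions φ, M.bellmanOp π f ∈ linearFunctions φ

/-- The MDP is an `(s, φ)`-sparse linear MDP. -/
def IsSparseLinear (s : ℕ) {d : ℕ} (φ : X → A → Fin d → ℝ) : Prop :=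
  M.IsLinear φ ∧
    ∃ K : Finset (Fin d), K.card ≤ s ∧ ∃ ψ : Fin d → X → ℝ,
      ∀ x a x', M.trans x a x' = ∑ k ∈ K, φ x a k * ψ k x'

end EpisodicMDP

/-- The smallest of the `d` singular values of a real `d × d` matrix (`d ≥ 1`). -/
def sigmaMin {d : ℕ} (Z : Matrix (Fin d) (Fin d) ℝ) : ℝ :=
  (Matrix.toEuclideanLin Z).singularValues (d - 1)

end

/-! The hard instances hide one key `k` among the `d - 2` coordinates other than `q` and `u`.
Features, rewards and initial law do not depend on `k`. Playing `k` at the start leads to the goal,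
and any other action leads to the absorbing trap, where nothing more can be learned or earned. Until
`k` is the first action of an episode, the data are therefore distributed as in `trapMDP`, which
does not know `k`. Each episode tests at most one key, so the probabilities of having tested a given
key within `n` episodes sum to at most `n`. For `n` at most half the number of keys, some key stays
untested with probability at least `1/2`, and each episode without it loses `H - 1`
(`le_hiddenMDP_regretFrom`, `exists_hiddenMDP_regret_ge`).

Sparsity holds because only the coordinates `q`, `u`, `k` enter the kernel. The probes provide good
exploration: trying keys one by one would excite each coordinate with weight of order `1/d`, whereas
a random sign vector excites all of them at constant strength. Probes have nonzero key coordinates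
only at the goal, so they do not help to find `k`. A policy that knows `k` reaches the goal with
probability `1/2` and then plays probes that keep it (`sum_sq_le_explore`). -/

/-! ### Singular values and averages over the simplex -/

/-- A coercivity bound on the quadratic form of a matrix bounds its smallest singular value. -/
theorem le_sigmaMin_of_quadraticForm {d : ℕ} (hd : 0 < d) (Z : Matrix (Fin d) (Fin d) ℝ) {c : ℝ}
    (hZ : ∀ v : Fin d → ℝ, c * ∑ i, v i ^ 2 ≤ v ⬝ᵥ Z.mulVec v) : c ≤ sigmaMin Z := by
  unfold sigmaMin
  set T := Matrix.toEuclideanLin Z with hT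
  have hn : d - 1 < Module.finrank ℝ (EuclideanSpace ℝ (Fin d)) := by simp; omega
  -- For a right singular vector `v` of the last singular value `σ`, Cauchy–Schwarz gives `c‖v‖² ≤
  -- ⟪v, T v⟫ ≤ ‖v‖‖T v‖ = σ‖v‖²`; symmetry of `Z` plays no role.
  obtain ⟨v, hv⟩ := (T.hasEigenvalue_adjoint_comp_self_sq_singularValues hn).exists_hasEigenvector
  have hv0 : 0 < ‖v‖ := norm_pos_iff.2 hv.2
  have hev : (LinearMap.adjoint T) (T v) = (T.singularValues (d - 1) ^ 2) • v := hv.apply_eq_smul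
  have hnorm : ‖T v‖ ^ 2 = (T.singularValues (d - 1) * ‖v‖) ^ 2 := by
    rw [← real_inner_self_eq_norm_sq, ← LinearMap.adjoint_inner_right, hev, real_inner_smul_right,
      real_inner_self_eq_norm_sq]
    ring
  have hTv : ‖T v‖ = T.singularValues (d - 1) * ‖v‖ :=
    (sq_eq_sq₀ (norm_nonneg _) (mul_nonneg (T.singularValues_nonneg _) hv0.le)).1 hnorm
  have hquad : c * ‖v‖ ^ 2 ≤ inner ℝ v (T v) := by
    have h := hZ v.ofLp
    rw [EuclideanSpace.norm_sq_eq]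
    simpa [T, Matrix.toLpLin_apply, PiLp.inner_apply, dotProduct, mul_comm] using h
  have hcs : inner ℝ v (T v) ≤ ‖v‖ * ‖T v‖ := real_inner_le_norm v (T v)
  rw [hTv] at hcs
  have : c * ‖v‖ ^ 2 ≤ T.singularValues (d - 1) * ‖v‖ ^ 2 := by nlinarith
  exact le_of_mul_le_mul_right this (by positivity)

theorem sum_vertex_mul {X : Type*} [Fintype X] [DecidableEq X] (y : X) (g : X → ℝ) :
    ∑ x, (stdSimplex.vertex y : stdSimplex ℝ X) x * g x = g y := by
  simp [Pi.single_apply]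

theorem sum_simplex_mul_const {X : Type*} [Fintype X] (p : stdSimplex ℝ X) (c : ℝ) :
    ∑ x, p x * c = c := by
  rw [← Finset.sum_mul, stdSimplex.sum_eq_one, one_mul]

/-! ### Expectations over an episode and monotonicity of the regret -/

namespace EpisodicMDP

variable {X A : Type*} [Fintype X] [Fintype A] (M : EpisodicMDP X A)

theorem episodeExpect_mono (π : HistoryPolicy X A) {f g : Episode X A → ℝ} (h : ∀ e, f e ≤ g e)
    (m : ℕ) (hist : List (X × A)) (x : X) :
    M.episodeExpect π f m hist x ≤ M.episodeExpect π g m hist x := by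
  induction m generalizing hist x with
  | zero => exact h _
  | succ m ih =>
    exact Finset.sum_le_sum fun a _ => mul_le_mul_of_nonneg_left
      (Finset.sum_le_sum fun x' _ => mul_le_mul_of_nonneg_left (ih _ _)
        (stdSimplex.zero_le _ _)) (stdSimplex.zero_le _ _)

theorem episodeExpect_const (π : HistoryPolicy X A) (c : ℝ) (m : ℕ) (hist : List (X × A)) (x : X) :
    M.episodeExpect π (fun _ => c) m hist x = c := by
  induction m generalizing hist x with
  | zero => rfl
  | succ m ih => simp only [episodeExpect, ih, sum_simplex_mul_const]

theorem episodeExpect_add (π : HistoryPolicy X A) (f g : Episode X A → ℝ) (m : ℕ)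
    (hist : List (X × A)) (x : X) :
    M.episodeExpect π (fun e => f e + g e) m hist x =
      M.episodeExpect π f m hist x + M.episodeExpect π g m hist x := by
  induction m generalizing hist x with
  | zero => rfl
  | succ m ih => simp only [episodeExpect, ih, mul_add, Finset.sum_add_distrib]

theorem episodeExpect_const_mul (π : HistoryPolicy X A) (c : ℝ) (f : Episode X A → ℝ) (m : ℕ)
    (hist : List (X × A)) (x : X) :
    M.episodeExpect π (fun e => c * f e) m hist x = c * M.episodeExpect π f m hist x := by
  induction m generalizing hist x with
  | zero => rfl
  | succ m ih =>
    simp only [episodeExpect, ih, Finset.mul_sum]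
    exact Finset.sum_congr rfl fun a _ => Finset.sum_congr rfl fun x' _ => by ring

theorem episodeExpect_sum {ι : Type*} (T : Finset ι) (π : HistoryPolicy X A)
    (f : ι → Episode X A → ℝ) (m : ℕ) (hist : List (X × A)) (x : X) :
    M.episodeExpect π (fun e => ∑ i ∈ T, f i e) m hist x =
      ∑ i ∈ T, M.episodeExpect π (f i) m hist x := by
  classical
  induction T using Finset.induction_on with
  | empty => simpa using M.episodeExpect_const π 0 m hist x
  | insert i T hi ih => simp only [Finset.sum_insert hi, episodeExpect_add, ih]

theorem episodeExpect_nonneg (π : HistoryPolicy X A) {f : Episode X A → ℝ} (h : ∀ e, 0 ≤ f e)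
    (m : ℕ) (hist : List (X × A)) (x : X) : 0 ≤ M.episodeExpect π f m hist x := by
  simpa [M.episodeExpect_const] using M.episodeExpect_mono π h m hist x

omit [Fintype A] in
theorem totalReward_append (hist : List (X × A)) (p : X × A) (x y : X) :
    M.totalReward (hist ++ [p], x) = M.totalReward (hist, y) + M.reward p.1 p.2 := by
  simp [totalReward]

theorem episodeExpect_totalReward_le (π : HistoryPolicy X A) (m : ℕ) (hist : List (X × A))
    (x : X) :
    M.episodeExpect π M.totalReward m hist x ≤ M.totalReward (hist, x) + m := by
  induction m generalizing hist x with
  | zero => simp [episodeExpect]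
  | succ m ih =>
    calc _ ≤ ∑ a, π hist x a * ∑ x', M.trans x a x' * (M.totalReward (hist, x) + (m + 1 : ℕ)) := by
          refine Finset.sum_le_sum fun a _ => mul_le_mul_of_nonneg_left
            (Finset.sum_le_sum fun x' _ => mul_le_mul_of_nonneg_left ?_
              (stdSimplex.zero_le _ _)) (stdSimplex.zero_le _ _)
          have h := ih (hist ++ [(x, a)]) x'
          rw [M.totalReward_append hist (x, a) x' x] at h
          have := (M.reward x a).2.2
          push_cast
          simp only at h
          linarith
      _ = _ := by simp only [sum_simplex_mul_const]

theorem value_le_horizon (π : HistoryPolicy X A) (x : X) : M.value π x ≤ M.horizon := by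
  simpa [value, totalReward] using M.episodeExpect_totalReward_le π M.horizon [] x

theorem value_le_optValue (π : HistoryPolicy X A) (x : X) : M.value π x ≤ M.optValue x :=
  le_ciSup (f := fun π => M.value π x)
    ⟨M.horizon, by rintro _ ⟨π, rfl⟩; exact M.value_le_horizon π x⟩ π

theorem regretFrom_nonneg (alg : Algorithm X A) (N : ℕ) (past : List (Episode X A)) :
    0 ≤ M.regretFrom alg N past := by
  induction N generalizing past with
  | zero => exact le_rfl
  | succ N ih =>
    exact Finset.sum_nonneg fun x _ => mul_nonneg (stdSimplex.zero_le _ _)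
      (add_nonneg (sub_nonneg.2 (M.value_le_optValue _ _))
        (M.episodeExpect_nonneg _ (fun e => ih _) _ _ _))

theorem regretFrom_le_succ (alg : Algorithm X A) (N : ℕ) (past : List (Episode X A)) :
    M.regretFrom alg N past ≤ M.regretFrom alg (N + 1) past := by
  induction N generalizing past with
  | zero => exact M.regretFrom_nonneg alg 1 past
  | succ N ih =>
    refine Finset.sum_le_sum fun x _ => mul_le_mul_of_nonneg_left ?_ (stdSimplex.zero_le _ _)
    exact add_le_add_right (M.episodeExpect_mono _ (fun e => ih _) _ _ _) _

theorem regret_monotone (alg : Algorithm X A) : Monotone (M.regret alg) :=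
  monotone_nat_of_le_succ fun N => M.regretFrom_le_succ alg N []

end EpisodicMDP

/-! ### First actions and the probability of missing one -/

/-- The indicator that the first action of an episode is not `a`. -/
noncomputable def avoidsFirst {X A : Type*} (a : A) (e : Episode X A) : ℝ :=
  open Classical in if e.1.head?.map Prod.snd = some a then 0 else 1

section avoidsFirst

variable {X A : Type*}

theorem avoidsFirst_nonneg (a : A) (e : Episode X A) : 0 ≤ avoidsFirst a e := by
  unfold avoidsFirst; split_ifs <;> norm_num

theorem avoidsFirst_le_one (a : A) (e : Episode X A) : avoidsFirst a e ≤ 1 := by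
  unfold avoidsFirst; split_ifs <;> norm_num

theorem avoidsFirst_cons_self (x : X) (a : A) (hist : List (X × A)) (y : X) :
    avoidsFirst a ((x, a) :: hist, y) = 0 := by
  simp [avoidsFirst]

theorem avoidsFirst_cons_of_ne {a b : A} (h : b ≠ a) (x : X) (hist : List (X × A)) (y : X) :
    avoidsFirst a ((x, b) :: hist, y) = 1 := by
  simp [avoidsFirst, h]

/-- An episode has at most one first action, so at most one summand is nonzero. -/
theorem sum_one_sub_avoidsFirst_le (T : Finset A) (e : Episode X A) :
    ∑ a ∈ T, (1 - avoidsFirst a e) ≤ 1 := by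
  classical
  have h (a : A) : 1 - avoidsFirst a e = if e.1.head?.map Prod.snd = some a then 1 else 0 := by
    unfold avoidsFirst; split_ifs <;> norm_num
  simp only [h]
  cases e.1.head?.map Prod.snd with
  | none => simp
  | some b => simp [Finset.sum_ite_eq]; split_ifs <;> norm_num

end avoidsFirst

namespace EpisodicMDP

variable {X A : Type*} [Fintype X] [Fintype A] (M : EpisodicMDP X A)

/-- Once the history is nonempty the first action is settled, and its indicator is a constant
factor. -/
theorem episodeExpect_avoidsFirst_mul (π : HistoryPolicy X A) (a : A) (f : Episode X A → ℝ)
    (m : ℕ) (p : X × A) (hist : List (X × A)) (x : X) :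
    M.episodeExpect π (fun e => avoidsFirst a e * f e) m (p :: hist) x =
      avoidsFirst a (p :: hist, x) * M.episodeExpect π f m (p :: hist) x := by
  induction m generalizing hist x with
  | zero => rfl
  | succ m ih =>
    have h (b : A) (x' : X) :
        avoidsFirst a (p :: (hist ++ [(x, b)]), x') = avoidsFirst a (p :: hist, x) := rfl
    simp only [episodeExpect, List.cons_append, ih, h, Finset.mul_sum]
    exact Finset.sum_congr rfl fun b _ => Finset.sum_congr rfl fun x' _ => by ring

/-- The probability that, in none of the next `n` episodes (all started at `x`), the first action
is `a`. -/
noncomputable def avoidProb (alg : Algorithm X A) (x : X) (a : A) :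
    ℕ → List (Episode X A) → ℝ
  | 0, _ => 1
  | n + 1, past => M.episodeExpect (alg past)
      (fun e => avoidsFirst a e * avoidProb alg x a n (past ++ [e])) M.horizon [] x

theorem avoidProb_nonneg (alg : Algorithm X A) (x : X) (a : A) (n : ℕ)
    (past : List (Episode X A)) : 0 ≤ M.avoidProb alg x a n past := by
  induction n generalizing past with
  | zero => exact zero_le_one
  | succ n ih =>
    exact M.episodeExpect_nonneg _ (fun e => mul_nonneg (avoidsFirst_nonneg _ _) (ih _)) _ _ _

theorem avoidProb_le_one (alg : Algorithm X A) (x : X) (a : A) (n : ℕ)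
    (past : List (Episode X A)) : M.avoidProb alg x a n past ≤ 1 := by
  induction n generalizing past with
  | zero => exact le_rfl
  | succ n ih =>
    rw [← M.episodeExpect_const (alg past) 1 M.horizon [] x]
    exact M.episodeExpect_mono _ (fun e => mul_le_one₀ (avoidsFirst_le_one _ _)
      (M.avoidProb_nonneg _ _ _ _ _) (ih _)) _ _ _

theorem avoidProb_antitone (alg : Algorithm X A) (x : X) (a : A) (past : List (Episode X A)) :
    Antitone fun n => M.avoidProb alg x a n past := by
  refine antitone_nat_of_succ_le fun n => ?_
  induction n generalizing past with
  | zero => exact M.avoidProb_le_one alg x a 1 past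
  | succ n ih =>
    exact M.episodeExpect_mono _
      (fun e => mul_le_mul_of_nonneg_left (ih _) (avoidsFirst_nonneg _ _)) _ _ _

/-- The sum is the expected number of distinct elements of `T` used as first actions, and each
episode adds at most one. -/
theorem sum_one_sub_avoidProb_le (alg : Algorithm X A) (x : X) (T : Finset A) (n : ℕ)
    (past : List (Episode X A)) : ∑ a ∈ T, (1 - M.avoidProb alg x a n past) ≤ n := by
  induction n generalizing past with
  | zero => simp [avoidProb]
  | succ n ih =>
    have h (a : A) : 1 - M.avoidProb alg x a (n + 1) past = M.episodeExpect (alg past)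
        (fun e => 1 + (-1) * (avoidsFirst a e * M.avoidProb alg x a n (past ++ [e])))
        M.horizon [] x := by
      rw [episodeExpect_add, episodeExpect_const, episodeExpect_const_mul]
      simp [avoidProb, sub_eq_add_neg]
    simp only [h]
    rw [← episodeExpect_sum, ← M.episodeExpect_const (alg past) ((n + 1 : ℕ) : ℝ) M.horizon [] x]
    refine M.episodeExpect_mono _ (fun e => ?_) _ _ _
    have h1 := sum_one_sub_avoidsFirst_le T e
    have h2 := ih (past ++ [e])
    -- Union bound `1 - xy ≤ (1 - x) + (1 - y)` for `x, y ≤ 1`.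
    calc _ ≤ ∑ a ∈ T, ((1 - avoidsFirst a e) + (1 - M.avoidProb alg x a n (past ++ [e]))) := by
          refine Finset.sum_le_sum fun a _ => ?_
          have := mul_nonneg (sub_nonneg.2 (avoidsFirst_le_one a e))
            (sub_nonneg.2 (M.avoidProb_le_one alg x a n (past ++ [e])))
          linarith
      _ ≤ _ := by rw [Finset.sum_add_distrib]; push_cast; linarith

end EpisodicMDP

/-! ### Deterministic transitions -/

namespace EpisodicMDP

variable {X A : Type*} [Fintype X] [DecidableEq X] [Fintype A]

/-- The MDP started at `x₀` with deterministic transitions `next`. -/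
def deterministic (H : ℕ) (x₀ : X) (r : X → A → Set.Icc (0 : ℝ) 1) (next : X → A → X) :
    EpisodicMDP X A where
  horizon := H
  init := stdSimplex.vertex x₀
  trans x a := stdSimplex.vertex (next x a)
  reward := r

variable (H : ℕ) (x₀ : X) (r : X → A → Set.Icc (0 : ℝ) 1) (next : X → A → X)

theorem deterministic_episodeExpect_succ (π : HistoryPolicy X A) (f : Episode X A → ℝ) (m : ℕ)
    (hist : List (X × A)) (x : X) :
    (deterministic H x₀ r next).episodeExpect π f (m + 1) hist x =
      ∑ a, π hist x a *
        (deterministic H x₀ r next).episodeExpect π f m (hist ++ [(x, a)]) (next x a) := by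
  simp only [episodeExpect, deterministic, sum_vertex_mul]

theorem deterministic_regretFrom_succ (alg : Algorithm X A) (N : ℕ) (past : List (Episode X A)) :
    (deterministic H x₀ r next).regretFrom alg (N + 1) past =
      (deterministic H x₀ r next).optValue x₀ -
        (deterministic H x₀ r next).value (alg past) x₀ +
      (deterministic H x₀ r next).episodeExpect (alg past)
        (fun e => (deterministic H x₀ r next).regretFrom alg N (past ++ [e])) H [] x₀ := by
  conv_lhs => unfold regretFrom
  exact sum_vertex_mul x₀ _

end EpisodicMDP

/-! ### The hidden key and the regret lower bound -/

open EpisodicMDP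

/-- Actions are either keys `Sum.inl k` or probes `Sum.inr σ`. The states are `0` (start), `1`
(trap) and `2` (goal). From the start only the key `k` leads to the goal, the trap is absorbing,
and the goal is kept by all keys and by the probes `σ` with `σ k = true`. -/
def hiddenNext {ι : Type*} [DecidableEq ι] (k : ι) (x : Fin 3) : ι ⊕ (ι → Bool) → Fin 3
  | Sum.inl i => if x = 2 ∨ (x = 0 ∧ i = k) then 2 else 1
  | Sum.inr σ => if x = 2 ∧ σ k = true then 2 else 1

/-- Only the goal pays: keys earn `1` there and probes `1 / 2`. -/
noncomputable def goalReward {ι : Type*} (x : Fin 3) : ι ⊕ (ι → Bool) → Set.Icc (0 : ℝ) 1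
  | Sum.inl _ => if x = 2 then 1 else 0
  | Sum.inr _ => if x = 2 then ⟨1 / 2, by norm_num, by norm_num⟩ else 0

theorem goalReward_of_ne {ι : Type*} {x : Fin 3} (hx : x ≠ 2) (a : ι ⊕ (ι → Bool)) :
    (goalReward x a : ℝ) = 0 := by
  cases a <;> simp [goalReward, hx]

section hiddenMDP

variable {ι A : Type*} [DecidableEq ι] [Fintype A] (e : A ≃ ι ⊕ (ι → Bool)) (H : ℕ) (k : ι)

/-- The MDP with hidden key `k`. -/
noncomputable def hiddenMDP : EpisodicMDP (Fin 3) A :=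
  deterministic H 0 (fun x a => goalReward x (e a)) fun x a => hiddenNext k x (e a)

/-- The MDP without a key: all actions lead to the trap. -/
noncomputable def trapMDP : EpisodicMDP (Fin 3) A :=
  deterministic H 0 (fun x a => goalReward x (e a)) fun _ _ => 1

omit [Fintype A] in
theorem hiddenMDP_trans (x : Fin 3) (a : A) :
    (hiddenMDP e H k).trans x a = stdSimplex.vertex (hiddenNext k x (e a)) := rfl

omit [Fintype A] in
theorem hiddenMDP_reward (x : Fin 3) (a : A) :
    (hiddenMDP e H k).reward x a = goalReward x (e a) := rfl

theorem hiddenNext_trap (a : ι ⊕ (ι → Bool)) : hiddenNext k 1 a = 1 := by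
  cases a <;> simp [hiddenNext]

theorem hiddenNext_start {a : ι ⊕ (ι → Bool)} (ha : a ≠ Sum.inl k) : hiddenNext k 0 a = 1 := by
  cases a with
  | inl i => simpa [hiddenNext] using ha
  | inr σ => simp [hiddenNext]

theorem hiddenMDP_episodeExpect_succ (π : HistoryPolicy (Fin 3) A) (f : Episode (Fin 3) A → ℝ)
    (m : ℕ) (hist : List (Fin 3 × A)) (x : Fin 3) :
    (hiddenMDP e H k).episodeExpect π f (m + 1) hist x = ∑ a, π hist x a *
      (hiddenMDP e H k).episodeExpect π f m (hist ++ [(x, a)]) (hiddenNext k x (e a)) :=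
  deterministic_episodeExpect_succ _ _ _ _ _ _ _ _ _

omit [DecidableEq ι] in
theorem trapMDP_episodeExpect_succ (π : HistoryPolicy (Fin 3) A) (f : Episode (Fin 3) A → ℝ)
    (m : ℕ) (hist : List (Fin 3 × A)) (x : Fin 3) :
    (trapMDP e H).episodeExpect π f (m + 1) hist x = ∑ a, π hist x a *
      (trapMDP e H).episodeExpect π f m (hist ++ [(x, a)]) 1 :=
  deterministic_episodeExpect_succ _ _ _ _ _ _ _ _ _

/-- The trap is absorbing in both processes, so nothing seen after entering it depends on `k`. -/
theorem hiddenMDP_episodeExpect_trap (π : HistoryPolicy (Fin 3) A) (f : Episode (Fin 3) A → ℝ)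
    (m : ℕ) (hist : List (Fin 3 × A)) :
    (hiddenMDP e H k).episodeExpect π f m hist 1 = (trapMDP e H).episodeExpect π f m hist 1 := by
  induction m generalizing hist with
  | zero => rfl
  | succ m ih =>
    simp only [hiddenMDP_episodeExpect_succ, trapMDP_episodeExpect_succ, hiddenNext_trap, ih]

/-- Until the key is played first, the MDP with hidden key behaves as the one without key. -/
theorem trapMDP_episodeExpect_avoidsFirst_le (π : HistoryPolicy (Fin 3) A)
    {f : Episode (Fin 3) A → ℝ} (hf : ∀ ep, 0 ≤ f ep) (m : ℕ) :
    (trapMDP e H).episodeExpect π (fun ep => avoidsFirst (e.symm (Sum.inl k)) ep * f ep)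
        (m + 1) [] 0 ≤ (hiddenMDP e H k).episodeExpect π f (m + 1) [] 0 := by
  rw [hiddenMDP_episodeExpect_succ, trapMDP_episodeExpect_succ]
  refine Finset.sum_le_sum fun a _ => mul_le_mul_of_nonneg_left ?_ (stdSimplex.zero_le _ _)
  rw [List.nil_append, episodeExpect_avoidsFirst_mul]
  by_cases ha : a = e.symm (Sum.inl k)
  · rw [ha, avoidsFirst_cons_self, zero_mul]
    exact episodeExpect_nonneg _ _ hf _ _ _
  · rw [avoidsFirst_cons_of_ne ha, one_mul,
      hiddenNext_start k fun h => ha (by rw [← h, e.symm_apply_apply]),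
      hiddenMDP_episodeExpect_trap]

theorem hiddenMDP_episodeExpect_totalReward_trap (π : HistoryPolicy (Fin 3) A) (m : ℕ)
    (hist : List (Fin 3 × A)) (x : Fin 3) :
    (hiddenMDP e H k).episodeExpect π (hiddenMDP e H k).totalReward m hist 1 =
      (hiddenMDP e H k).totalReward (hist, x) := by
  induction m generalizing hist with
  | zero => rfl
  | succ m ih =>
    simp only [hiddenMDP_episodeExpect_succ, hiddenNext_trap, ih,
      totalReward_append _ hist _ x x, hiddenMDP_reward,
      goalReward_of_ne (show (1 : Fin 3) ≠ 2 by decide), add_zero, sum_simplex_mul_const]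

omit [DecidableEq ι] in
theorem trapMDP_avoidProb_one (alg : Algorithm (Fin 3) A) (m : ℕ) (a : A)
    (past : List (Episode (Fin 3) A)) :
    (trapMDP e (m + 1)).avoidProb alg 0 a 1 past =
      ∑ b, alg past [] 0 b * avoidsFirst a ([((0 : Fin 3), b)], (1 : Fin 3)) := by
  simp only [avoidProb]
  change (trapMDP e (m + 1)).episodeExpect _ _ (m + 1) _ _ = _
  rw [trapMDP_episodeExpect_succ]
  refine Finset.sum_congr rfl fun b _ => ?_
  rw [List.nil_append, episodeExpect_avoidsFirst_mul, episodeExpect_const, mul_one]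

/-- The start pays nothing and a wrong first action leads to the trap. Only the event that `k` is
played first contributes, with at most `1` in each of the `m` remaining steps. -/
theorem hiddenMDP_value_le (alg : Algorithm (Fin 3) A) (m : ℕ)
    (past : List (Episode (Fin 3) A)) :
    (hiddenMDP e (m + 1) k).value (alg past) 0 ≤
      m * (1 - (trapMDP e (m + 1)).avoidProb alg 0 (e.symm (Sum.inl k)) 1 past) := by
  have hsum : (m : ℝ) * (1 - (trapMDP e (m + 1)).avoidProb alg 0 (e.symm (Sum.inl k)) 1 past) =
      ∑ b, alg past [] 0 b * (m * (1 - avoidsFirst (e.symm (Sum.inl k))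
        ([((0 : Fin 3), b)], (1 : Fin 3)))) := by
    rw [trapMDP_avoidProb_one]
    nth_rewrite 1 [← sum_simplex_mul_const (alg past [] 0) 1]
    rw [← Finset.sum_sub_distrib, Finset.mul_sum]
    exact Finset.sum_congr rfl fun b _ => by ring
  rw [hsum]
  change (hiddenMDP e (m + 1) k).episodeExpect _ _ (m + 1) _ _ ≤ _
  rw [hiddenMDP_episodeExpect_succ]
  refine Finset.sum_le_sum fun a _ => mul_le_mul_of_nonneg_left ?_ (stdSimplex.zero_le _ _)
  have h0 (x : Fin 3) : (hiddenMDP e (m + 1) k).totalReward ([] ++ [((0 : Fin 3), a)], x) = 0 := by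
    simp [totalReward, hiddenMDP_reward, goalReward_of_ne (show (0 : Fin 3) ≠ 2 by decide)]
  by_cases ha : a = e.symm (Sum.inl k)
  · rw [ha, avoidsFirst_cons_self]
    rw [ha] at h0
    refine (episodeExpect_totalReward_le _ _ _ _ _).trans ?_
    rw [h0]
    simp
  · rw [avoidsFirst_cons_of_ne ha,
      hiddenNext_start k fun h => ha (by rw [← h, e.symm_apply_apply]),
      hiddenMDP_episodeExpect_totalReward_trap _ _ _ _ _ _ 0, h0]
    simp

/-- Playing `k` forever pays `0` at the start and `1` at the goal in the other `m` steps. -/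
theorem le_hiddenMDP_optValue [DecidableEq A] (m : ℕ) :
    (m : ℝ) ≤ (hiddenMDP e (m + 1) k).optValue 0 := by
  set π : HistoryPolicy (Fin 3) A := fun _ _ => stdSimplex.vertex (e.symm (Sum.inl k)) with hπ
  have hgoal (n : ℕ) (hist : List (Fin 3 × A)) : (hiddenMDP e (m + 1) k).episodeExpect π
      (hiddenMDP e (m + 1) k).totalReward n hist 2 =
        (hiddenMDP e (m + 1) k).totalReward (hist, 2) + n := by
    induction n generalizing hist with
    | zero => simp [episodeExpect]
    | succ n ih =>
      rw [hiddenMDP_episodeExpect_succ]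
      simp only [hπ, sum_vertex_mul] at ih ⊢
      have hnext : hiddenNext k 2 (Sum.inl k : ι ⊕ (ι → Bool)) = 2 := by simp [hiddenNext]
      have hr : ((goalReward 2 (Sum.inl k : ι ⊕ (ι → Bool)) : Set.Icc (0 : ℝ) 1) : ℝ) = 1 := by
        simp [goalReward]
      rw [e.apply_symm_apply, hnext, ih, totalReward_append _ hist _ 2 2, hiddenMDP_reward,
        e.apply_symm_apply, hr]
      push_cast
      ring
  refine le_trans (le_of_eq ?_) (value_le_optValue _ π 0)
  change _ = (hiddenMDP e (m + 1) k).episodeExpect π _ (m + 1) [] 0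
  rw [hiddenMDP_episodeExpect_succ]
  simp only [hπ, sum_vertex_mul] at hgoal ⊢
  have hnext : hiddenNext k 0 (Sum.inl k : ι ⊕ (ι → Bool)) = 2 := by simp [hiddenNext]
  rw [e.apply_symm_apply, hnext, hgoal]
  simp [totalReward, hiddenMDP_reward, goalReward_of_ne (show (0 : Fin 3) ≠ 2 by decide)]

/-- On the event that `k` is missed in all `N` episodes, each of them loses `m`; the probability of
this event may be computed in `trapMDP`. -/
theorem le_hiddenMDP_regretFrom (alg : Algorithm (Fin 3) A) (m N : ℕ)
    (past : List (Episode (Fin 3) A)) :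
    m * (N * (trapMDP e (m + 1)).avoidProb alg 0 (e.symm (Sum.inl k)) N past) ≤
      (hiddenMDP e (m + 1) k).regretFrom alg N past := by
  classical
  induction N generalizing past with
  | zero => simp [regretFrom]
  | succ N ih =>
    set a := e.symm (Sum.inl k) with ha
    set Q := (trapMDP e (m + 1)).avoidProb alg 0 a with hQ
    have hopt := le_hiddenMDP_optValue e k m
    have hval := hiddenMDP_value_le e k alg m past
    have hstep : m * N * Q (N + 1) past ≤ (hiddenMDP e (m + 1) k).episodeExpect (alg past)
        (fun ep => (hiddenMDP e (m + 1) k).regretFrom alg N (past ++ [ep])) (m + 1) [] 0 := by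
      refine le_trans ?_ (trapMDP_episodeExpect_avoidsFirst_le e (m + 1) k (alg past)
        (fun ep => regretFrom_nonneg _ _ _ _) m)
      rw [hQ, avoidProb, ← episodeExpect_const_mul]
      refine episodeExpect_mono _ _ (fun ep => ?_) _ _ _
      calc _ = avoidsFirst a ep * (m * (N * Q N (past ++ [ep]))) := by rw [hQ]; ring
        _ ≤ _ := mul_le_mul_of_nonneg_left (ih _) (avoidsFirst_nonneg _ _)
    -- The current episode loses at least `m * Q 1 past`, which is weakened to `m * Q (N + 1) past`
    -- to match the later episodes.
    have hanti : Q (N + 1) past ≤ Q 1 past :=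
      (trapMDP e (m + 1)).avoidProb_antitone alg 0 a past (by omega)
    have hmul := mul_le_mul_of_nonneg_left hanti (Nat.cast_nonneg (α := ℝ) m)
    rw [show (hiddenMDP e (m + 1) k).regretFrom alg (N + 1) past = _ from
      deterministic_regretFrom_succ _ _ _ _ _ _ _]
    change _ ≤ (hiddenMDP e (m + 1) k).optValue 0 - (hiddenMDP e (m + 1) k).value (alg past) 0 +
      (hiddenMDP e (m + 1) k).episodeExpect (alg past)
        (fun ep => (hiddenMDP e (m + 1) k).regretFrom alg N (past ++ [ep])) (m + 1) [] 0
    push_cast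
    linarith

/-- A nonempty set `T` of keys contains one for which the regret grows linearly during the first
`n ≤ #T / 2` episodes. -/
theorem exists_hiddenMDP_regret_ge (alg : Algorithm (Fin 3) A) (m n : ℕ) (T : Finset ι)
    (hT : 0 < T.card) (hn : 2 * n ≤ T.card) :
    ∃ k ∈ T, ∀ N ≤ n, (m : ℝ) * N / 2 ≤ (hiddenMDP e (m + 1) k).regret alg N := by
  set Q : ι → ℕ → ℝ := fun k N => (trapMDP e (m + 1)).avoidProb alg 0 (e.symm (Sum.inl k)) N []
  have hsum : ∑ k ∈ T, (1 - Q k n) ≤ n := by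
    have h := (trapMDP e (m + 1)).sum_one_sub_avoidProb_le alg 0
      (T.map ((Function.Embedding.inl).trans e.symm.toEmbedding)) n []
    simpa using h
  -- The average over `T` of the probabilities of testing a key is at most `n / #T ≤ 1 / 2`.
  obtain ⟨k, hk, hle⟩ : ∃ k ∈ T, 1 - Q k n ≤ 1 / 2 := by
    refine Finset.exists_le_of_sum_le (Finset.card_pos.1 hT) (hsum.trans ?_)
    have : (2 * n : ℝ) ≤ T.card := by exact_mod_cast hn
    simp only [Finset.sum_const, nsmul_eq_mul]
    linarith
  refine ⟨k, hk, fun N hN => le_trans ?_ (le_hiddenMDP_regretFrom e k alg m N [])⟩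
  have hanti : Q k n ≤ Q k N := (trapMDP e (m + 1)).avoidProb_antitone alg 0 _ [] hN
  have : (1 : ℝ) / 2 ≤ Q k N := by linarith
  have h := mul_le_mul_of_nonneg_left this (by positivity : (0 : ℝ) ≤ m * N)
  change _ ≤ (m : ℝ) * (N * Q k N)
  linarith

end hiddenMDP

/-! ### Second moments of random signs -/

/-- The sign `1` of `true` and `-1` of `false`. -/
noncomputable def boolSign (b : Bool) : ℝ := if b then 1 else -1

theorem boolSign_not (b : Bool) : boolSign (!b) = -boolSign b := by
  cases b <;> simp [boolSign]

theorem boolSign_mul_self (b : Bool) : boolSign b * boolSign b = 1 := by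
  cases b <;> simp [boolSign]

theorem one_add_boolSign_nonneg (b : Bool) : 0 ≤ 1 + boolSign b := by
  cases b <;> norm_num [boolSign]

section Cube

variable {ι : Type*} [Fintype ι] [DecidableEq ι]

theorem sum_cube_boolSign (i : ι) : ∑ σ : ι → Bool, boolSign (σ i) = 0 := by
  have hinv : Function.Involutive fun (σ : ι → Bool) (j : ι) => !σ j := fun σ => by simp
  have h := Equiv.sum_comp hinv.toPerm fun σ : ι → Bool => boolSign (σ i)
  simp only [Function.Involutive.coe_toPerm, boolSign_not, Finset.sum_neg_distrib] at h
  linarith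

theorem sum_cube_boolSign_mul (i j : ι) :
    ∑ σ : ι → Bool, boolSign (σ i) * boolSign (σ j) =
      if i = j then 2 ^ Fintype.card ι else 0 := by
  split_ifs with hij
  · subst hij
    simp [boolSign_mul_self]
  -- Flipping only the sign `i` negates the product, so its sum vanishes.
  · have hinv : Function.Involutive fun σ : ι → Bool => Function.update σ i (!σ i) :=
      fun σ => by simp
    have h := Equiv.sum_comp hinv.toPerm fun σ : ι → Bool => boolSign (σ i) * boolSign (σ j)
    simp only [Function.Involutive.coe_toPerm, Function.update_self,
      Function.update_of_ne (Ne.symm hij), boolSign_not, neg_mul, Finset.sum_neg_distrib] at h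
    linarith

/-- Parseval: distinct coordinate signs are orthogonal on the cube. -/
theorem sum_cube_sq (w : ι → ℝ) :
    ∑ σ : ι → Bool, (∑ j, w j * boolSign (σ j)) ^ 2 = 2 ^ Fintype.card ι * ∑ j, w j ^ 2 := by
  have h (σ : ι → Bool) : (∑ j, w j * boolSign (σ j)) ^ 2 =
      ∑ i, ∑ j, w i * w j * (boolSign (σ i) * boolSign (σ j)) := by
    rw [sq, Finset.sum_mul_sum]
    exact Finset.sum_congr rfl fun i _ => Finset.sum_congr rfl fun j _ => by ring
  simp only [h]
  rw [Finset.sum_comm, Finset.mul_sum]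
  refine Finset.sum_congr rfl fun i _ => ?_
  rw [Finset.sum_comm]
  simp only [← Finset.mul_sum, sum_cube_boolSign_mul]
  simp
  ring

/-- Second moments of an affine form of a uniformly random sign vector with positive `k`-th
coordinate. -/
theorem sum_cube_one_add_boolSign_mul_sq (k : ι) (α : ℝ) (w : ι → ℝ) :
    ∑ σ : ι → Bool, (1 + boolSign (σ k)) * (α + ∑ j, w j * boolSign (σ j)) ^ 2 =
      2 ^ Fintype.card ι * ((α + w k) ^ 2 + (∑ j, w j ^ 2 - w k ^ 2)) := by
  have hinv : Function.Involutive fun (σ : ι → Bool) (j : ι) => !σ j := fun σ => by simp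
  have hneg := Equiv.sum_comp hinv.toPerm fun σ : ι → Bool =>
    (1 + boolSign (σ k)) * (α + ∑ j, w j * boolSign (σ j)) ^ 2
  simp only [Function.Involutive.coe_toPerm, boolSign_not, mul_neg,
    Finset.sum_neg_distrib] at hneg
  -- Where the sign `k` is `1`, the constant `α` equals `α` times that sign and can be absorbed into
  -- `w k`. Averaging with the image under negation of all signs turns the restricted sum into a
  -- full one.
  have hsq := sum_cube_sq fun j => w j + if j = k then α else 0
  have hw : ∑ j, (w j + if j = k then α else 0) ^ 2 =
      (α + w k) ^ 2 + (∑ j, w j ^ 2 - w k ^ 2) := by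
    have (j : ι) : (w j + if j = k then α else 0) ^ 2 =
        w j ^ 2 + if j = k then (α + w k) ^ 2 - w k ^ 2 else 0 := by
      split_ifs with h
      · subst h; ring
      · ring
    simp only [this, Finset.sum_add_distrib, Finset.sum_ite_eq', Finset.mem_univ, if_true]
    ring
  rw [hw] at hsq
  rw [← hsq]
  have hadd : ∀ σ : ι → Bool,
      2 * (∑ j, (w j + if j = k then α else 0) * boolSign (σ j)) ^ 2 =
        (1 + boolSign (σ k)) * (α + ∑ j, w j * boolSign (σ j)) ^ 2 +
          (1 + -boolSign (σ k)) * (α + -∑ j, w j * boolSign (σ j)) ^ 2 := by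
    intro σ
    have : ∑ j, (w j + if j = k then α else 0) * boolSign (σ j) =
        ∑ j, w j * boolSign (σ j) + α * boolSign (σ k) := by
      simp [add_mul, Finset.sum_add_distrib]
    rw [this]
    linear_combination (2 * α ^ 2) * boolSign_mul_self (σ k)
  have htot := Finset.sum_congr (rfl : (Finset.univ : Finset (ι → Bool)) = _) fun σ _ => hadd σ
  rw [← Finset.mul_sum, Finset.sum_add_distrib, hneg] at htot
  linarith

end Cube

/-! ### Covariance as a quadratic form, and a criterion for sparsity -/

namespace EpisodicMDP

variable {X A : Type*} [Fintype X] [Fintype A] (M : EpisodicMDP X A)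

theorem stateLaw_nonneg (π : StationaryPolicy X A) (h : ℕ) (x : X) : 0 ≤ M.stateLaw π h x := by
  induction h generalizing x with
  | zero => exact stdSimplex.zero_le _ _
  | succ h ih =>
    exact Finset.sum_nonneg fun y _ => Finset.sum_nonneg fun a _ =>
      mul_nonneg (mul_nonneg (ih y) (stdSimplex.zero_le _ _)) (stdSimplex.zero_le _ _)

theorem covariance_quadraticForm {d : ℕ} (φ : X → A → Fin d → ℝ) (π : StationaryPolicy X A)
    (v : Fin d → ℝ) :
    v ⬝ᵥ (M.covariance φ π).mulVec v = (1 / (M.horizon : ℝ)) *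
      ∑ h ∈ Finset.range M.horizon, ∑ x, M.stateLaw π h x * ∑ a, π x a * (φ x a ⬝ᵥ v) ^ 2 := by
  have hrank (w : Fin d → ℝ) : v ⬝ᵥ (Matrix.vecMulVec w w).mulVec v = (w ⬝ᵥ v) ^ 2 := by
    rw [Matrix.vecMulVec_mulVec, dotProduct_smul, dotProduct_comm v w]
    simp [sq]
  simp only [covariance, Matrix.smul_mulVec, Matrix.sum_mulVec, dotProduct_smul, dotProduct_sum,
    hrank, smul_eq_mul, Finset.mul_sum, mul_assoc]

/-- A sparse transition kernel and a linear reward make an MDP linear. -/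
theorem isSparseLinear_of_reward {d : ℕ} (φ : X → A → Fin d → ℝ) (s : ℕ) (K : Finset (Fin d))
    (hK : K.card ≤ s) (ψ : Fin d → X → ℝ)
    (hψ : ∀ x a x', M.trans x a x' = ∑ k ∈ K, φ x a k * ψ k x')
    (w : Fin d → ℝ) (hw : ∀ x a, (M.reward x a : ℝ) = φ x a ⬝ᵥ w) : M.IsSparseLinear s φ := by
  refine ⟨fun π f _ => ?_, K, hK, ψ, hψ⟩
  -- With a factored kernel, `f` enters the backup only through the integrals of its policy averages
  -- against `ψ i`, which become the weights.
  refine ⟨fun i => w i + if i ∈ K then ∑ x', ψ i x' * ∑ a', π x' a' * f x' a' else 0,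
    fun x a => ?_⟩
  have h : ∑ x', M.trans x a x' * ∑ a', π x' a' * f x' a' =
      ∑ i, φ x a i * if i ∈ K then ∑ x', ψ i x' * ∑ a', π x' a' * f x' a' else 0 := by
    simp only [hψ, mul_ite, mul_zero, Finset.sum_ite_mem, Finset.univ_inter]
    simp only [Finset.sum_mul]
    rw [Finset.sum_comm]
    refine Finset.sum_congr rfl fun i _ => ?_
    rw [Finset.mul_sum]
    exact Finset.sum_congr rfl fun x' _ => by ring
  simp only [bellmanOp, h, hw, dotProduct, mul_add, Finset.sum_add_distrib]

end EpisodicMDP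

/-! ### The feature map shared by all keys -/

section features

variable {ι : Type*} [DecidableEq ι]

/-- The features of the key coordinates. -/
noncomputable def keyFeature (x : Fin 3) : ι ⊕ (ι → Bool) → ι → ℝ
  | Sum.inl j, i => if x = 0 ∧ i = j then 1 else 0
  | Sum.inr σ, i => if x = 2 then boolSign (σ i) / 2 else 0

/-- The feature map known to the learner: the coordinate `q` is constant, and the coordinate `u` is
one minus the reward. -/
noncomputable def hiddenFeature (q u : ι) (x : Fin 3) (a : ι ⊕ (ι → Bool)) (i : ι) : ℝ :=
  if i = q then 1 else if i = u then 1 - goalReward x a else keyFeature x a i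

theorem abs_hiddenFeature_le_one (q u : ι) (x : Fin 3) (a : ι ⊕ (ι → Bool)) (i : ι) :
    |hiddenFeature q u x a i| ≤ 1 := by
  unfold hiddenFeature
  split_ifs
  · simp
  · have := (goalReward x a).2
    rw [abs_le]
    constructor <;> linarith [this.1, this.2]
  · cases a with
    | inl j => simp only [keyFeature]; split_ifs <;> simp
    | inr σ =>
      simp only [keyFeature]
      split_ifs
      · cases σ i <;> norm_num [boolSign]
      · simp

theorem sum_hiddenFeature_mul [Fintype ι] {q u : ι} (hqu : q ≠ u) (x : Fin 3)
    (a : ι ⊕ (ι → Bool)) (v : ι → ℝ) :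
    ∑ i, hiddenFeature q u x a i * v i = v q + (1 - goalReward x a) * v u +
      ∑ i, if i = q ∨ i = u then 0 else keyFeature x a i * v i := by
  have h (i : ι) : hiddenFeature q u x a i * v i = (if i = q then v q else 0) +
      (if i = u then (1 - goalReward x a) * v u else 0) +
      if i = q ∨ i = u then 0 else keyFeature x a i * v i := by
    unfold hiddenFeature
    by_cases h1 : i = q
    · subst h1; simp [hqu]
    · by_cases h2 : i = u
      · subst h2; simp [h1]
      · simp [h1, h2]
  simp only [h, Finset.sum_add_distrib, Finset.sum_ite_eq', Finset.mem_univ, if_true]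

end features

/-! ### Sparsity and exploration with a hidden key -/

section exploration

variable {d : ℕ} {A : Type*} [Fintype A] (e : A ≃ Fin d ⊕ (Fin d → Bool)) (H : ℕ)
  (k : Fin d)

theorem hiddenMDP_isSparseLinear {q u : Fin d} (hqu : q ≠ u) (hkq : k ≠ q) (hku : k ≠ u) :
    (hiddenMDP e H k).IsSparseLinear 3 fun x a => hiddenFeature q u x (e a) := by
  -- The goal is reached with probability `1 - φ_u + φ_k` and the trap with `φ_u - φ_k`; the reward
  -- is `φ_q - φ_u`.
  refine isSparseLinear_of_reward _ _ 3 {q, u, k} Finset.card_le_three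
    (fun i => if i = q then ![0, 0, 1] else if i = u then ![0, 1, -1] else ![0, -1, 1]) ?_
    (fun i => if i = q then 1 else if i = u then -1 else 0) ?_
  · intro x a y
    rw [hiddenMDP_trans, Finset.sum_insert (by simp [hqu, hkq.symm]),
      Finset.sum_insert (by simp [hku.symm]), Finset.sum_singleton]
    simp only [hiddenFeature, if_true, hqu.symm, hkq, hku, if_false]
    rcases e a with j | σ
    · by_cases hj : j = k
      · subst hj
        fin_cases x <;> fin_cases y <;> simp [hiddenNext, goalReward, keyFeature]
      · fin_cases x <;> fin_cases y <;>
          simp [hiddenNext, goalReward, keyFeature, hj, Ne.symm hj]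
    · cases hσ : σ k <;> fin_cases x <;> fin_cases y <;>
        simp [hiddenNext, goalReward, keyFeature, boolSign, hσ] <;> norm_num
  · intro x a
    rw [dotProduct, sum_hiddenFeature_mul hqu]
    simp only [hiddenMDP_reward, if_true, hqu.symm, if_false]
    have (i : Fin d) : (if i = q ∨ i = u then 0 else keyFeature x (e a) i *
        if i = q then 1 else if i = u then -1 else 0) = (0 : ℝ) := by
      by_cases h1 : i = q
      · simp [h1]
      · by_cases h2 : i = u <;> simp [h1, h2]
    simp only [this, Finset.sum_const_zero]
    ring

/-- The weights of the exploratory policy: play the key `k` with probability `1 / 2`, otherwise a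
uniformly random probe among those which keep the goal. -/
noncomputable def exploreWeight : Fin d ⊕ (Fin d → Bool) → ℝ
  | Sum.inl i => if i = k then 1 / 2 else 0
  | Sum.inr σ => (1 + boolSign (σ k)) / 2 ^ (d + 1)

theorem exploreWeight_nonneg (a : Fin d ⊕ (Fin d → Bool)) : 0 ≤ exploreWeight k a := by
  cases a with
  | inl i => simp only [exploreWeight]; split_ifs <;> norm_num
  | inr σ => exact div_nonneg (one_add_boolSign_nonneg _) (by positivity)

theorem sum_exploreWeight_mul (F : Fin d ⊕ (Fin d → Bool) → ℝ) :
    ∑ a, exploreWeight k (e a) * F (e a) = 1 / 2 * F (Sum.inl k) +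
      1 / 2 ^ (d + 1) * ∑ σ : Fin d → Bool, (1 + boolSign (σ k)) * F (Sum.inr σ) := by
  rw [Equiv.sum_comp e fun b => exploreWeight k b * F b, Fintype.sum_sum_type, Finset.mul_sum]
  congr 1
  · simp [exploreWeight]
  · exact Finset.sum_congr rfl fun σ _ => by simp only [exploreWeight]; ring

theorem sum_one_add_boolSign : ∑ σ : Fin d → Bool, (1 + boolSign (σ k)) = 2 ^ d := by
  simp [Finset.sum_add_distrib, sum_cube_boolSign]

/-- The exploratory policy for the hidden key `k`. -/
noncomputable def explorePolicy : StationaryPolicy (Fin 3) A := fun _ =>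
  ⟨fun a => exploreWeight k (e a), fun a => exploreWeight_nonneg k (e a), by
    have h := sum_exploreWeight_mul e k fun _ => 1
    simp only [mul_one, sum_one_add_boolSign] at h
    rw [h, pow_succ]
    field_simp
    norm_num⟩

theorem explorePolicy_apply (x : Fin 3) (a : A) :
    explorePolicy e k x a = exploreWeight k (e a) := rfl

/-- Probes with `σ k = false` have weight zero, so all probes in the support move alike. -/
theorem sum_explorePolicy_mul_trans (x y : Fin 3) :
    ∑ a, explorePolicy e k x a * (hiddenMDP e H k).trans x a y =
      1 / 2 * (if y = hiddenNext k x (Sum.inl k) then 1 else 0) +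
        1 / 2 * (if y = (if x = 2 then 2 else 1) then 1 else 0) := by
  have hprobe (σ : Fin d → Bool) :
      (1 + boolSign (σ k)) *
          (stdSimplex.vertex (hiddenNext k x (Sum.inr σ)) : stdSimplex ℝ (Fin 3)) y =
        (1 + boolSign (σ k)) * (if y = (if x = 2 then 2 else 1) then 1 else 0) := by
    cases hσ : σ k <;> simp [boolSign, hiddenNext, hσ, Pi.single_apply]
  simp only [explorePolicy_apply, hiddenMDP_trans]
  rw [sum_exploreWeight_mul e k fun b =>
    (stdSimplex.vertex (hiddenNext k x b) : stdSimplex ℝ (Fin 3)) y]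
  simp only [hprobe, ← Finset.sum_mul, sum_one_add_boolSign]
  simp only [stdSimplex.vertex_coe, Pi.single_apply, pow_succ]
  field_simp

/-- The first action is `k` or a probe with probability `1 / 2` each, leading to the goal or the
trap; under this policy neither is left again. -/
theorem hiddenMDP_stateLaw_succ (h : ℕ) (y : Fin 3) :
    (hiddenMDP e H k).stateLaw (explorePolicy e k) (h + 1) y = if y = 0 then 0 else 1 / 2 := by
  have hrec (n : ℕ) (y : Fin 3) : (hiddenMDP e H k).stateLaw (explorePolicy e k) (n + 1) y =
      ∑ x, (hiddenMDP e H k).stateLaw (explorePolicy e k) n x *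
        (1 / 2 * (if y = hiddenNext k x (Sum.inl k) then 1 else 0) +
        1 / 2 * (if y = (if x = 2 then 2 else 1) then 1 else 0)) := by
    simp only [← sum_explorePolicy_mul_trans e H, Finset.mul_sum, ← mul_assoc]
    rfl
  induction h generalizing y with
  | zero =>
    have h0 (x : Fin 3) : (hiddenMDP e H k).stateLaw (explorePolicy e k) 0 x =
        (stdSimplex.vertex 0 : stdSimplex ℝ (Fin 3)) x := rfl
    rw [hrec]
    simp only [h0, sum_vertex_mul]
    fin_cases y <;> simp [hiddenNext]
  | succ h ih =>
    rw [hrec]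
    simp only [Fin.sum_univ_three, ih]
    fin_cases y <;> simp [hiddenNext] <;> norm_num

/-- The features seen in the trap and in the goal are well conditioned under the exploratory
policy. -/
theorem sum_sq_le_explore {q u : Fin d} (hqu : q ≠ u) (hkq : k ≠ q) (hku : k ≠ u)
    (v : Fin d → ℝ) :
    1 / 48 * ∑ i, v i ^ 2 ≤
      1 / 2 * ∑ a, explorePolicy e k 1 a * (hiddenFeature q u 1 (e a) ⬝ᵥ v) ^ 2 +
        1 / 2 * ∑ a, explorePolicy e k 2 a * (hiddenFeature q u 2 (e a) ⬝ᵥ v) ^ 2 := by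
  set w : Fin d → ℝ := fun i => if i = q ∨ i = u then 0 else v i / 2 with hw
  have htrap (a : Fin d ⊕ (Fin d → Bool)) : hiddenFeature q u 1 a ⬝ᵥ v = v q + v u := by
    rw [dotProduct, sum_hiddenFeature_mul hqu]
    cases a <;> simp [goalReward, keyFeature]
  have hkey (i : Fin d) : hiddenFeature q u 2 (Sum.inl i) ⬝ᵥ v = v q := by
    rw [dotProduct, sum_hiddenFeature_mul hqu]
    simp [goalReward, keyFeature]
  have hprobe (σ : Fin d → Bool) : hiddenFeature q u 2 (Sum.inr σ) ⬝ᵥ v =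
      (v q + v u / 2) + ∑ i, w i * boolSign (σ i) := by
    rw [dotProduct, sum_hiddenFeature_mul hqu]
    congr 1
    · norm_num [goalReward]; ring
    · refine Finset.sum_congr rfl fun i _ => ?_
      simp only [hw, keyFeature]
      split_ifs <;> ring
  have hv : ∑ i, v i ^ 2 = v q ^ 2 + v u ^ 2 + 4 * ∑ i, w i ^ 2 := by
    have (i : Fin d) : v i ^ 2 = (if i = q then v q ^ 2 else 0) +
        (if i = u then v u ^ 2 else 0) + 4 * w i ^ 2 := by
      by_cases h1 : i = q
      · subst h1; simp [hw, hqu]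
      · by_cases h2 : i = u
        · subst h2; simp [hw, h1]
        · simp only [hw, h1, h2, or_self, if_false]; ring
    rw [Finset.mul_sum]
    conv_lhs => rw [Finset.sum_congr rfl fun i _ => this i]
    simp only [Finset.sum_add_distrib, Finset.sum_ite_eq', Finset.mem_univ, if_true]
  have hR : w k ^ 2 ≤ ∑ i, w i ^ 2 :=
    Finset.single_le_sum (f := fun i => w i ^ 2) (fun i _ => sq_nonneg _) (Finset.mem_univ k)
  have h1 : ∑ a, explorePolicy e k 1 a * (hiddenFeature q u 1 (e a) ⬝ᵥ v) ^ 2 =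
      (v q + v u) ^ 2 := by
    simp only [htrap, sum_simplex_mul_const]
  have h2 : ∑ a, explorePolicy e k 2 a * (hiddenFeature q u 2 (e a) ⬝ᵥ v) ^ 2 =
      1 / 2 * v q ^ 2 + 1 / 2 * ((v q + v u / 2 + w k) ^ 2 + (∑ i, w i ^ 2 - w k ^ 2)) := by
    simp only [explorePolicy_apply]
    rw [sum_exploreWeight_mul e k fun b => (hiddenFeature q u 2 b ⬝ᵥ v) ^ 2, hkey]
    simp only [hprobe]
    rw [sum_cube_one_add_boolSign_mul_sq, Fintype.card_fin, pow_succ 2 d]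
    field_simp
  rw [h1, h2, hv]
  -- With `a = v q`, `b = v q + v u`, `t = v q + v u / 2 + w k`, one has `v u = b - a` and `2 * w k
  -- = 2t - a - b`. Then `(b - a)² ≤ 2a² + 2b²` and `(2t - a - b)² ≤ 3(4t² + a² + b²)`; the
  -- coefficient `12 / 48` of `t²` is exactly the available `1 / 4`.
  nlinarith [sq_nonneg (2 * (v q + v u / 2 + w k) + v q), sq_nonneg (v q - (v q + v u)),
    sq_nonneg (2 * (v q + v u / 2 + w k) + (v q + v u)), sq_nonneg (v q + (v q + v u)),
    sq_nonneg (2 * (v q + v u / 2 + w k)), sq_nonneg (v q), sq_nonneg (v q + v u)]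

theorem explorePolicy_exploratory {q u : Fin d} (hqu : q ≠ u) (hkq : k ≠ q) (hku : k ≠ u)
    (hH : 2 ≤ H) :
    1 / 96 ≤ sigmaMin ((hiddenMDP e H k).covariance
      (fun x a => hiddenFeature q u x (e a)) (explorePolicy e k)) := by
  refine le_sigmaMin_of_quadraticForm (Fin.pos k) _ fun v => ?_
  rw [covariance_quadraticForm]
  change _ ≤ 1 / (H : ℝ) * ∑ h ∈ Finset.range H, _
  obtain ⟨m, rfl⟩ : ∃ m, H = m + 1 := ⟨H - 1, by omega⟩
  -- The first step, spent at the start, is only bounded below by zero; the other `m` of `m + 1`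
  -- steps keep at least half of `1 / 48`.
  rw [Finset.sum_range_succ']
  set S := ∑ i, v i ^ 2
  have hS : 0 ≤ S := Finset.sum_nonneg fun i _ => sq_nonneg _
  have h0 : 0 ≤ ∑ x, (hiddenMDP e (m + 1) k).stateLaw (explorePolicy e k) 0 x *
      ∑ a, explorePolicy e k x a * (hiddenFeature q u x (e a) ⬝ᵥ v) ^ 2 :=
    Finset.sum_nonneg fun x _ => mul_nonneg (stateLaw_nonneg _ _ _ _)
      (Finset.sum_nonneg fun a _ => mul_nonneg (stdSimplex.zero_le _ _) (sq_nonneg _))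
  have hstep (h : ℕ) : 1 / 48 * S ≤
      ∑ x, (hiddenMDP e (m + 1) k).stateLaw (explorePolicy e k) (h + 1) x *
        ∑ a, explorePolicy e k x a * (hiddenFeature q u x (e a) ⬝ᵥ v) ^ 2 := by
    simp only [hiddenMDP_stateLaw_succ, Fin.sum_univ_three]
    simpa using sum_sq_le_explore e k hqu hkq hku v
  have hsum := Finset.card_nsmul_le_sum (Finset.range m) _ _ fun h _ => hstep h
  rw [Finset.card_range, nsmul_eq_mul] at hsum
  have hm : (1 : ℝ) ≤ m := by exact_mod_cast (by omega : 1 ≤ m)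
  rw [one_div_mul_eq_div ((m + 1 : ℕ) : ℝ), le_div_iff₀ (by positivity)]
  push_cast
  nlinarith

end exploration

/-! ### Choice of the key and of the constants -/

theorem theorem1 :
    ∃ (S s : ℕ) (c : ℝ) (nA : ℕ → ℕ), 0 < c ∧ (∀ d, d ≤ nA d) ∧
      ∀ d : ℕ, 5 ≤ d → ∀ H : ℕ, 2 ≤ H →
        -- what the learner may know in advance: initial law, rewards, feature map
        ∃ (ξ₀ : stdSimplex ℝ (Fin S)) (r : Fin S → Fin (nA d) → Set.Icc (0 : ℝ) 1)
          (φ : Fin S → Fin (nA d) → Fin d → ℝ),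
          (∀ x a i, |φ x a i| ≤ 1) ∧
          ∀ alg : Algorithm (Fin S) (Fin (nA d)),
            ∃ M : EpisodicMDP (Fin S) (Fin (nA d)),
              M.horizon = H ∧ M.init = ξ₀ ∧ M.reward = r ∧
              M.IsSparseLinear s φ ∧
              (∃ πe : StationaryPolicy (Fin S) (Fin (nA d)),
                c ≤ sigmaMin (M.covariance φ πe)) ∧
              (∀ N : ℕ, N ≤ d → 1 / 128 * (H * N : ℝ) ≤ M.regret alg N) ∧
              (∀ N : ℕ, d ≤ N → 1 / 128 * (H * d : ℝ) ≤ M.regret alg N) := by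
  refine ⟨3, 3, 1 / 96, fun d => Fintype.card (Fin d ⊕ (Fin d → Bool)), by norm_num,
    fun d => by simp, fun d hd H hH => ?_⟩
  obtain ⟨m, rfl⟩ : ∃ m, H = m + 1 := ⟨H - 1, by omega⟩
  set e := (Fintype.equivFin (Fin d ⊕ (Fin d → Bool))).symm
  set q : Fin d := ⟨0, by omega⟩ with hq
  set u : Fin d := ⟨1, by omega⟩ with hu
  have hqu : q ≠ u := by simp [hq, hu]
  refine ⟨stdSimplex.vertex 0, fun x a => goalReward x (e a),
    fun x a => hiddenFeature q u x (e a), fun x a i => abs_hiddenFeature_le_one q u x (e a) i,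
    fun alg => ?_⟩
  have hcard : ((Finset.univ.erase q).erase u).card = d - 2 := by
    rw [Finset.card_erase_of_mem (by simp [hqu.symm]), Finset.card_erase_of_mem (by simp),
      Finset.card_univ, Fintype.card_fin]
    omega
  obtain ⟨k, hk, hreg⟩ := exists_hiddenMDP_regret_ge e alg m ((d - 2) / 2)
    ((Finset.univ.erase q).erase u) (by omega) (by omega)
  simp only [Finset.mem_erase, Finset.mem_univ, and_true] at hk
  have hm : (1 : ℝ) ≤ m := by exact_mod_cast (by omega : 1 ≤ m)
  set n := (d - 2) / 2
  -- This uses `d ≥ 5`, with equality at `d = 5`, `n = 1`. Together with `m + 1 ≤ 2 * m`, the bound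
  -- `m * n / 2` is at least `(m + 1) * d / 20`.
  have hn : (d : ℝ) ≤ 5 * n := by exact_mod_cast (by omega : d ≤ 5 * n)
  have hmono := (hiddenMDP e (m + 1) k).regret_monotone alg
  have hlate : ((m + 1 : ℕ) * d : ℝ) / 128 ≤ (hiddenMDP e (m + 1) k).regret alg n := by
    refine le_trans ?_ (hreg n le_rfl)
    have := mul_le_mul_of_nonneg_left hn (by positivity : (0 : ℝ) ≤ m)
    have := mul_le_mul_of_nonneg_right hm (by positivity : (0 : ℝ) ≤ d)
    push_cast
    linarith
  refine ⟨hiddenMDP e (m + 1) k, rfl, rfl, rfl,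
    hiddenMDP_isSparseLinear e (m + 1) k hqu hk.2 hk.1,
    ⟨explorePolicy e k, explorePolicy_exploratory e (m + 1) k hqu hk.2 hk.1 hH⟩, ?_, ?_⟩
  · intro N hN
    rcases le_total N n with h | h
    · refine le_trans ?_ (hreg N h)
      have := mul_le_mul_of_nonneg_right hm (by positivity : (0 : ℝ) ≤ N)
      push_cast
      linarith
    -- Beyond `n` episodes, monotonicity keeps the regret above its value at `n`, already of order
    -- `H * d`.
    · refine le_trans ?_ (hlate.trans (hmono h))
      have hNd : (N : ℝ) ≤ d := by exact_mod_cast hN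
      have := mul_le_mul_of_nonneg_left hNd (by positivity : (0 : ℝ) ≤ ((m + 1 : ℕ) : ℝ))
      linarith
  · intro N hN
    refine le_trans ?_ (hlate.trans (hmono (by omega : n ≤ N)))
    linarith
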